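/- Let $K$ be a field and let $[X]$ be a cancellative commutative monoid, whose elements are called power-products (for instance all products of powers of $x_0,\dots,x_{n-1}$, or of infinitely many indeterminates), equipped with an admissible order $\preceq$, i.e. a linear order with least element $1$ such that $s\preceq t$ implies $su\preceq tu$. Let $K[X]$ be the $K$-algebra with basis $[X]$ (for the standard power-products, the polynomial ring). For a linearly ordered set $I$ of component indices let $K[X]^{I}$ be the free $K[X]$-module with basis $(e_i)_{i\in I}$ (for $I=\{0,\dots,k-1\}$ this is $K[X]^k$). Its terms $t\,e_i$ ($t\in[X]$, $i\in I$) are ordered by the position-over-term (POT) order: $s\,e_i\preceq_{\sf t}t\,e_j$ iff $i<j$, or $i=j$ and $s\preceq t$. For $f\neq 0$, the leading term $\mathrm{lt}(f)$ is the largest term occurring in $f$ with non-zero coefficient, and $\mathrm{lc}(f)$ is that coefficient. For a set $F$ write $p\to_F q$ if there are $f\in F\setminus\{0\}$ and $t\in[X]$ such that, with $\mathrm{lt}(f)=s\,e_j$, the coefficient $c$ of $(ts)\,e_j$ in $p$ is non-zero and $q=p-\frac{c}{\mathrm{lc}(f)}\,t\,f$. A set $G$ is a Gröbner basis if $\to_G$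 is confluent, i.e. if $p\to_G^*q$ and $p\to_G^*r$ imply that there is $z$ with $q\to_G^*z$ and $r\to_G^*z$. Let $bs=[b_0,\dots,b_{m-1}]$ be a list of pairwise distinct elements of $K[X]^{I}$. Its syzygy module is $\mathrm{Syz}(bs)=\{(s_0,\dots,s_{m-1})\in K[X]^m : \sum_{i<m}s_ib_i=0\}$. Let $I'$ consist of $m$ new indices $0<\dots<m-1$ followed by all the indices in $I$, so that $K[X]^{I'}=K[X]^m\oplus K[X]^I$, and let $bs'$ be the list of the vectors $(e_i,b_i)\in K[X]^{I'}$, $0\le i<m$. Let $gs$ be a finite list in $K[X]^{I'}$ that is a Gröbner basis with respect to the POT order and generates the same submodule of $K[X]^{I'}$ as $bs'$. Let $syz$ be the list of those $(s_0,\dots,s_{m-1})\in K[X]^m$ for which $(s_0,\dots,s_{m-1},0)$ occurs in $gs$. Then 1. $syz$ generates the submodule $\mathrm{Syz}(bs)$ of $K[X]^m$, and 2. $syz$ is a Gröbner basis with respect to the POT order on $K[X]^m$ extending $\preceq$. -/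

import Mathlib

/-!
Vectors of polynomials, term orders, polynomial reduction, Groebner bases and syzygies.

Power-products form a cancellative commutative monoid `α`, written additively, so that the ring of
polynomials over `K` is `AddMonoidAlgebra K α`; for `α = (σ →₀ ℕ)` this is `MvPolynomial σ K`.
Vector-polynomials with components indexed by `ι` are the elements of the free module
`ι →₀ AddMonoidAlgebra K α`; a term `t e_i` is the pair `(t, i) : α × ι`. The submodule generated
by a set `F` is `Submodule.span (AddMonoidAlgebra K α) F`.
-/

noncomputable section

namespace GB

/-- Admissible orders on power-products: linear orders for which the trivial power-product is
least and which are compatible with multiplication (written `+`). -/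
structure IsAdmissible {α : Type*} [AddCommMonoid α] (le : α → α → Prop) : Prop where
  refl : ∀ s, le s s
  antisymm : ∀ s t, le s t → le t s → s = t
  trans : ∀ s t u, le s t → le t u → le s u
  total : ∀ s t, le s t ∨ le t s
  zero_le : ∀ t, le 0 t
  add_mono : ∀ s t u, le s t → le (s + u) (t + u)

/-- The position-over-term extension of an order on power-products to an order on terms:
`s e_i ≼ t e_j` iff `i < j`, or `i = j` and `s ≼ t`. -/
def potLE {α ι : Type*} [LT ι] (le : α → α → Prop) (u v : α × ι) : Prop :=
  u.2 < v.2 ∨ (u.2 = v.2 ∧ le u.1 v.1)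

variable {K : Type*} [Field K] {α : Type*} [AddCancelCommMonoid α] {ι : Type*}

/-- The coefficient of the term `v` in the vector-polynomial `p`. -/
def coeff (p : ι →₀ AddMonoidAlgebra K α) (v : α × ι) : K :=
  (p v.2).coeff v.1

/-- `v` is the leading term of `p` with respect to the order `leT` on terms: the largest term that
occurs in `p` with non-zero coefficient. No term is a leading term of `0`. -/
def IsLeadingTerm (leT : α × ι → α × ι → Prop) (p : ι →₀ AddMonoidAlgebra K α)
    (v : α × ι) : Prop :=
  coeff p v ≠ 0 ∧ ∀ u, coeff p u ≠ 0 → leT u v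

/-- `p` reduces to `q` modulo `f` using the power-product `t`; with `s e_j` the leading term of
`f`, this subtracts from `p` the multiple of `f` that cancels the term `(t s) e_j`. -/
def RedSingle (leT : α × ι → α × ι → Prop) (p q f : ι →₀ AddMonoidAlgebra K α) (t : α) : Prop :=
  ∃ (s : α) (j : ι), IsLeadingTerm leT f (s, j) ∧ coeff p (t + s, j) ≠ 0 ∧
    q = p - AddMonoidAlgebra.single t (coeff p (t + s, j) / coeff f (s, j)) • f

/-- The reduction relation modulo a set `F`. -/
def Red (leT : α × ι → α × ι → Prop) (F : Set (ι →₀ AddMonoidAlgebra K α))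
    (p q : ι →₀ AddMonoidAlgebra K α) : Prop :=
  ∃ f ∈ F, f ≠ 0 ∧ ∃ t : α, RedSingle leT p q f t

/-- `G` is a Groebner basis with respect to `leT` if the reduction relation modulo `G` is
confluent. -/
def IsGroebnerBasis (leT : α × ι → α × ι → Prop) (G : Set (ι →₀ AddMonoidAlgebra K α)) : Prop :=
  ∀ p q r, Relation.ReflTransGen (Red leT G) p q → Relation.ReflTransGen (Red leT G) p r →
    ∃ z, Relation.ReflTransGen (Red leT G) q z ∧ Relation.ReflTransGen (Red leT G) r z

variable {κ : Type*}

/-- The vectors `(e_i, b_i)`, where `bs = [b_0, …, b_{m-1}]`. The type `Fin m ⊕ₗ κ` of indices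
consists of `m` new components followed by all the original ones. -/
def initSyzygyList (bs : List (κ →₀ AddMonoidAlgebra K α)) :
    List ((Fin bs.length ⊕ₗ κ) →₀ AddMonoidAlgebra K α) :=
  List.ofFn fun i : Fin bs.length =>
    Finsupp.single (Sum.inlₗ i) 1 +
      Finsupp.mapDomain (fun j : κ => (Sum.inrₗ j : Fin bs.length ⊕ₗ κ)) (bs.get i)

/-- The restriction of a vector to its first `m` components. -/
def restrictFirst {m : ℕ} (g : (Fin m ⊕ₗ κ) →₀ AddMonoidAlgebra K α) :
    Fin m →₀ AddMonoidAlgebra K α :=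
  Finsupp.equivFunOnFinite.symm fun i => g (Sum.inlₗ i)

open Classical in
/-- Those elements of `gs` of the form `(s_0, …, s_{m-1}, 0, …, 0)`, restricted to
`(s_0, …, s_{m-1})`. -/
def filterSyzygyBasis {m : ℕ} (gs : List ((Fin m ⊕ₗ κ) →₀ AddMonoidAlgebra K α)) :
    List (Fin m →₀ AddMonoidAlgebra K α) :=
  (gs.filter fun g => decide (∀ j : κ, g (Sum.inrₗ j) = 0)).map restrictFirst

/-- The syzygy module of `bs = [b_0, …, b_{m-1}]`: all `(s_0, …, s_{m-1})` such that
`∑ i, s_i b_i = 0`. -/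
def syzygyModule (bs : List (κ →₀ AddMonoidAlgebra K α)) :
    Submodule (AddMonoidAlgebra K α) (Fin bs.length →₀ AddMonoidAlgebra K α) where
  carrier := {s | ∑ i, s i • bs.get i = 0}
  zero_mem' := by simp
  add_mem' := by
    intro a b ha hb
    simp only [Set.mem_ofPred_eq] at ha hb ⊢
    simp only [Finsupp.add_apply, add_smul, Finset.sum_add_distrib, ha, hb, add_zero]
  smul_mem' := by
    intro c a ha
    simp only [Set.mem_ofPred_eq] at ha ⊢
    simp only [Finsupp.smul_apply, smul_eq_mul, mul_smul, ← Finset.smul_sum, ha, smul_zero]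

end GB

end

/-! The submodule generated by the `(e_i, b_i)` consists of the vectors `(s, ∑ s_i b_i)`, so `(s,
0)` lies in it exactly when `s` is a syzygy. Position-over-term makes this an elimination order: an
element of `gs` whose leading term is in the first `m` components vanishes in all others. Hence only
elements `(f, 0)` of `gs` can reduce a vector `(p, 0)`, and `extendFirst` identifies reduction
modulo `syz` with reduction modulo `gs` on its image (`red_extendFirst`,
`exists_of_red_extendFirst`). Confluence transfers at once. For generation, a syzygy `s` gives `(s,
0)` in the span of `gs`; this reduces to `0` by confluence, and the reduction takes place inside the
image. -/

open Relation in
/-- A reflexive-transitive closure is carried along a map that sends steps to steps. -/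
theorem Relation.ReflTransGen.exists_of_map_step {β γ : Type*} {r : β → β → Prop}
    {s : γ → γ → Prop} {E : β → γ} (h : ∀ p y, s (E p) y → ∃ q, y = E q ∧ r p q) {p : β} {y : γ}
    (hy : ReflTransGen s (E p) y) : ∃ q, y = E q ∧ ReflTransGen r p q := by
  induction hy with
  | refl => exact ⟨p, rfl, .refl⟩
  | tail _ hstep ih =>
    obtain ⟨q, rfl, hq⟩ := ih
    obtain ⟨q', rfl, hq'⟩ := h _ _ hstep
    exact ⟨q', rfl, hq.tail hq'⟩

namespace GB

theorem IsAdmissible.exists_max {α : Type*} [AddCommMonoid α] {le : α → α → Prop}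
    (hle : IsAdmissible le) (s : Finset α) (hs : s.Nonempty) : ∃ a ∈ s, ∀ b ∈ s, le b a := by
  induction hs using Finset.Nonempty.cons_induction with
  | singleton a => exact ⟨a, by simp, by simpa using hle.refl a⟩
  | cons a s ha hs ih =>
    obtain ⟨b, hb, hmax⟩ := ih
    rcases hle.total a b with h | h
    · refine ⟨b, by simp [hb], fun c hc => ?_⟩
      rcases Finset.mem_cons.1 hc with rfl | hc
      exacts [h, hmax c hc]
    · refine ⟨a, by simp, fun c hc => ?_⟩
      rcases Finset.mem_cons.1 hc with rfl | hc
      exacts [hle.refl _, hle.trans _ _ _ (hmax c hc) h]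

/-! ### Confluence and membership in the generated submodule -/

section Reduction

variable {K : Type*} [Field K] {α : Type*} [AddCancelCommMonoid α] {ι : Type*}

theorem coeff_add (p q : ι →₀ AddMonoidAlgebra K α) (v : α × ι) :
    coeff (p + q) v = coeff p v + coeff q v := by
  simp [coeff]

theorem coeff_single_smul (p : ι →₀ AddMonoidAlgebra K α) (t s : α) (j : ι) (c : K) :
    coeff (AddMonoidAlgebra.single t c • p) (t + s, j) = c * coeff p (s, j) := by
  simp [coeff]

theorem exists_isLeadingTerm [LinearOrder ι] {le : α → α → Prop} (hle : IsAdmissible le)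
    {p : ι →₀ AddMonoidAlgebra K α} (hp : p ≠ 0) :
    ∃ v, IsLeadingTerm (potLE le) p v := by
  have hs : p.support.Nonempty := Finsupp.support_nonempty_iff.2 hp
  set j := p.support.max' hs
  have hj : p j ≠ 0 := Finsupp.mem_support_iff.1 (p.support.max'_mem hs)
  obtain ⟨s, hsj, hmax⟩ := hle.exists_max (p j).coeff.support
    (Finsupp.support_nonempty_iff.2 (by simpa using hj))
  refine ⟨(s, j), Finsupp.mem_support_iff.1 hsj, ?_⟩
  rintro ⟨t, i⟩ hu
  have hi : p i ≠ 0 := fun h => hu (by simp [coeff, h])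
  rcases (p.support.le_max' i (Finsupp.mem_support_iff.2 hi)).lt_or_eq with h | h
  · exact Or.inl h
  · change i = j at h
    subst h
    exact Or.inr ⟨rfl, hmax t (Finsupp.mem_support_iff.2 hu)⟩

/-- Subtracting the right multiple of `f` from `p` is a reduction or leaves `p` unchanged. -/
theorem reflTransGen_red_sub {leT : α × ι → α × ι → Prop} {F : Set (ι →₀ AddMonoidAlgebra K α)}
    {f : ι →₀ AddMonoidAlgebra K α} (hf : f ∈ F) (hf0 : f ≠ 0) {s : α} {j : ι}
    (hlt : IsLeadingTerm leT f (s, j)) (p : ι →₀ AddMonoidAlgebra K α) (t : α) :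
    Relation.ReflTransGen (Red leT F) p
      (p - AddMonoidAlgebra.single t (coeff p (t + s, j) / coeff f (s, j)) • f) := by
  by_cases h : coeff p (t + s, j) = 0
  · simpa [h] using Relation.ReflTransGen.refl
  · exact .single ⟨f, hf, hf0, t, s, j, hlt, h, rfl⟩

/-- Cancelling the term `t · lt(f)` in both vectors gives the same result, since they differ by a
multiple of `t f`. -/
theorem exists_join_add_single_smul [LinearOrder ι] {le : α → α → Prop} (hle : IsAdmissible le)
    {F : Set (ι →₀ AddMonoidAlgebra K α)} {f : ι →₀ AddMonoidAlgebra K α} (hf : f ∈ F)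
    (p : ι →₀ AddMonoidAlgebra K α) (t : α) (c : K) :
    ∃ z, Relation.ReflTransGen (Red (potLE le) F) p z ∧
      Relation.ReflTransGen (Red (potLE le) F) (p + AddMonoidAlgebra.single t c • f) z := by
  by_cases hf0 : f = 0
  · exact ⟨p, .refl, by simpa [hf0] using Relation.ReflTransGen.refl⟩
  obtain ⟨⟨s, j⟩, hlt⟩ := exists_isLeadingTerm hle hf0
  refine ⟨_, reflTransGen_red_sub hf hf0 hlt p t, ?_⟩
  convert reflTransGen_red_sub hf hf0 hlt (p + AddMonoidAlgebra.single t c • f) t using 1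
  rw [coeff_add, coeff_single_smul, add_div, mul_div_cancel_right₀ _ hlt.1,
    AddMonoidAlgebra.single_add, add_smul]
  abel

theorem eq_zero_of_reflTransGen_red_zero {leT : α × ι → α × ι → Prop}
    {F : Set (ι →₀ AddMonoidAlgebra K α)} {z : ι →₀ AddMonoidAlgebra K α}
    (h : Relation.ReflTransGen (Red leT F) 0 z) : z = 0 := by
  induction h with
  | refl => rfl
  | tail _ hstep ih =>
    subst ih
    obtain ⟨f, -, -, t, s, j, -, hc, -⟩ := hstep
    exact absurd (by simp [coeff]) hc

/-- Confluence suffices, without termination: adding a multiple of a generator preserves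
reducibility to `0`. -/
theorem IsGroebnerBasis.reflTransGen_red_zero [LinearOrder ι] {le : α → α → Prop}
    (hle : IsAdmissible le) {G : Set (ι →₀ AddMonoidAlgebra K α)}
    (hG : IsGroebnerBasis (potLE le) G) {x : ι →₀ AddMonoidAlgebra K α}
    (hx : x ∈ Submodule.span (AddMonoidAlgebra K α) G) :
    Relation.ReflTransGen (Red (potLE le) G) x 0 := by
  -- Quantifying over `a` and `p` lets the induction on the span absorb scalars and add summands one
  -- at a time.
  suffices H : ∀ (a : AddMonoidAlgebra K α) (p : ι →₀ AddMonoidAlgebra K α),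
      Relation.ReflTransGen (Red (potLE le) G) p 0 →
        Relation.ReflTransGen (Red (potLE le) G) (p + a • x) 0 by
    simpa using H 1 0 .refl
  induction hx using Submodule.span_induction with
  | mem g hg =>
    intro a
    induction a using AddMonoidAlgebra.induction_linear with
    | zero => simp
    | add a b ha hb =>
      intro p hp
      rw [add_smul, ← add_assoc]
      exact hb _ (ha _ hp)
    | single t c =>
      intro p hp
      obtain ⟨z, hz, hz'⟩ := exists_join_add_single_smul hle hg p t c
      -- Both `z` and `0` are reached from `p`, and `0` is irreducible, so `z` reduces to `0`.
      obtain ⟨w, hw, hw'⟩ := hG p z 0 hz hp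
      rw [eq_zero_of_reflTransGen_red_zero hw'] at hw
      exact hz'.trans hw
  | zero => simp
  | add x y _ _ hx hy =>
    intro a p hp
    rw [smul_add, ← add_assoc]
    exact hy _ _ (hx _ _ hp)
  | smul b x _ hx =>
    intro a p hp
    rw [smul_smul]
    exact hx _ _ hp

theorem mem_span_of_reflTransGen_red_zero {leT : α × ι → α × ι → Prop}
    {F : Set (ι →₀ AddMonoidAlgebra K α)} {p : ι →₀ AddMonoidAlgebra K α}
    (h : Relation.ReflTransGen (Red leT F) p 0) : p ∈ Submodule.span (AddMonoidAlgebra K α) F := by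
  induction h using Relation.ReflTransGen.head_induction_on with
  | refl => exact zero_mem _
  | head hstep _ ih =>
    obtain ⟨f, hf, -, t, s, j, -, -, rfl⟩ := hstep
    exact ((Submodule.span _ F).sub_mem_iff_left
      (Submodule.smul_mem _ _ (Submodule.subset_span hf))).1 ih

end Reduction

/-! ### Elimination: reduction inside the first `m` components -/

section Extension

variable {K : Type*} [Field K] {α : Type*} [AddCancelCommMonoid α] {κ : Type*} {m : ℕ}

variable (K α κ m) in
/-- The embedding of `K[X]^m` as the first `m` components, `s ↦ (s, 0)`. -/
noncomputable def extendFirst :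
    (Fin m →₀ AddMonoidAlgebra K α) →ₗ[AddMonoidAlgebra K α]
      ((Fin m ⊕ₗ κ) →₀ AddMonoidAlgebra K α) :=
  Finsupp.lmapDomain _ _ fun i => Sum.inlₗ i

@[simp]
theorem extendFirst_apply_inl (p : Fin m →₀ AddMonoidAlgebra K α) (i : Fin m) :
    extendFirst K α κ m p (Sum.inlₗ i) = p i :=
  Finsupp.mapDomain_apply (toLex.injective.comp Sum.inl_injective) p i

@[simp]
theorem extendFirst_apply_inr (p : Fin m →₀ AddMonoidAlgebra K α) (j : κ) :
    extendFirst K α κ m p (Sum.inrₗ j) = 0 :=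
  Finsupp.mapDomain_of_notMem_range _ _ (by rintro ⟨i, hi⟩; simp at hi)

theorem extendFirst_injective : Function.Injective (extendFirst K α κ m) :=
  Finsupp.mapDomain_injective (toLex.injective.comp Sum.inl_injective)

@[simp]
theorem restrictFirst_apply (g : (Fin m ⊕ₗ κ) →₀ AddMonoidAlgebra K α) (i : Fin m) :
    restrictFirst g i = g (Sum.inlₗ i) := rfl

theorem restrictFirst_extendFirst (p : Fin m →₀ AddMonoidAlgebra K α) :
    restrictFirst (extendFirst K α κ m p) = p := by
  ext1 i
  simp

theorem extendFirst_restrictFirst {g : (Fin m ⊕ₗ κ) →₀ AddMonoidAlgebra K α}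
    (hg : ∀ j : κ, g (Sum.inrₗ j) = 0) : extendFirst K α κ m (restrictFirst g) = g := by
  ext1 i
  induction i using Lex.rec with | _ i
  rcases i with i | j
  · exact extendFirst_apply_inl _ i
  · exact (extendFirst_apply_inr _ j).trans (hg j).symm

theorem mem_filterSyzygyBasis {gs : List ((Fin m ⊕ₗ κ) →₀ AddMonoidAlgebra K α)}
    {f : Fin m →₀ AddMonoidAlgebra K α} :
    f ∈ filterSyzygyBasis gs ↔ extendFirst K α κ m f ∈ gs := by
  simp only [filterSyzygyBasis, List.mem_map, List.mem_filter, decide_eq_true_eq]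
  constructor
  · rintro ⟨g, ⟨hg, hg0⟩, rfl⟩
    rwa [extendFirst_restrictFirst hg0]
  · exact fun h => ⟨_, ⟨h, extendFirst_apply_inr f⟩, restrictFirst_extendFirst f⟩

@[simp]
theorem coeff_extendFirst_inl (p : Fin m →₀ AddMonoidAlgebra K α) (s : α) (i : Fin m) :
    coeff (extendFirst K α κ m p) (s, Sum.inlₗ i) = coeff p (s, i) := by
  simp [coeff]

@[simp]
theorem coeff_extendFirst_inr (p : Fin m →₀ AddMonoidAlgebra K α) (s : α) (j : κ) :
    coeff (extendFirst K α κ m p) (s, Sum.inrₗ j) = 0 := by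
  simp [coeff]

variable [LinearOrder κ]

theorem isLeadingTerm_extendFirst {le : α → α → Prop} {f : Fin m →₀ AddMonoidAlgebra K α} {s : α}
    {j : Fin m} :
    IsLeadingTerm (potLE le) (extendFirst K α κ m f) (s, Sum.inlₗ j) ↔
      IsLeadingTerm (potLE le) f (s, j) := by
  simp only [IsLeadingTerm, coeff_extendFirst_inl]
  refine and_congr_right fun _ => ⟨fun h u hu => ?_, ?_⟩
  · simpa [potLE] using h (u.1, Sum.inlₗ u.2) (by simpa using hu)
  · rintro h ⟨t, i⟩ hu
    induction i using Lex.rec with | _ i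
    rcases i with i | i
    · simpa [potLE] using h (t, i) ((coeff_extendFirst_inl f t i).symm.trans_ne hu)
    · exact absurd (coeff_extendFirst_inr f t i) hu

/-- A vector whose leading term lies in the first `m` components vanishes in all others. -/
theorem IsLeadingTerm.apply_inr_eq_zero {le : α → α → Prop}
    {f : (Fin m ⊕ₗ κ) →₀ AddMonoidAlgebra K α} {s : α} {i : Fin m}
    (h : IsLeadingTerm (potLE le) f (s, Sum.inlₗ i)) (j : κ) : f (Sum.inrₗ j) = 0 := by
  by_contra hj
  obtain ⟨t, ht⟩ := Finsupp.ne_iff.1 (mt AddMonoidAlgebra.coeff_eq_zero.1 hj)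
  simpa [potLE] using h.2 (t, Sum.inrₗ j) ht

theorem red_extendFirst {le : α → α → Prop} {gs : List ((Fin m ⊕ₗ κ) →₀ AddMonoidAlgebra K α)}
    {p q : Fin m →₀ AddMonoidAlgebra K α}
    (h : Red (potLE le) {s | s ∈ filterSyzygyBasis gs} p q) :
    Red (potLE le) {g | g ∈ gs} (extendFirst K α κ m p) (extendFirst K α κ m q) := by
  obtain ⟨f, hf, hf0, t, s, j, hlt, hc, rfl⟩ := h
  refine ⟨extendFirst K α κ m f, mem_filterSyzygyBasis.1 hf,
    (map_ne_zero_iff _ extendFirst_injective).2 hf0, t, s, Sum.inlₗ j,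
    isLeadingTerm_extendFirst.2 hlt, ?_, ?_⟩ <;> simp [hc]

/-- The cancelled term lies in the first `m` components, hence so does the leading term of the
reducer, which is therefore itself in the image of `extendFirst`. -/
theorem exists_of_red_extendFirst {le : α → α → Prop}
    {gs : List ((Fin m ⊕ₗ κ) →₀ AddMonoidAlgebra K α)} (p : Fin m →₀ AddMonoidAlgebra K α)
    (y : (Fin m ⊕ₗ κ) →₀ AddMonoidAlgebra K α)
    (h : Red (potLE le) {g | g ∈ gs} (extendFirst K α κ m p) y) :
    ∃ q, y = extendFirst K α κ m q ∧ Red (potLE le) {s | s ∈ filterSyzygyBasis gs} p q := by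
  obtain ⟨g, hg, hg0, t, s, j, hlt, hc, rfl⟩ := h
  induction j using Lex.rec with | _ j
  rcases j with j | j
  · change IsLeadingTerm (potLE le) g (s, Sum.inlₗ j) at hlt
    have hgE := extendFirst_restrictFirst hlt.apply_inr_eq_zero
    generalize restrictFirst g = f at hgE
    subst hgE
    refine ⟨_, ?_, f, mem_filterSyzygyBasis.2 hg, fun h => hg0 (by simp [h]), t, s, j,
      isLeadingTerm_extendFirst.1 hlt, (coeff_extendFirst_inl p (t + s) j).symm.trans_ne hc, rfl⟩
    rw [map_sub, map_smul, ← coeff_extendFirst_inl (κ := κ) p, ← coeff_extendFirst_inl (κ := κ) f]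
  · exact absurd (coeff_extendFirst_inr p (t + s) j) hc

theorem IsGroebnerBasis.filterSyzygyBasis {le : α → α → Prop}
    {gs : List ((Fin m ⊕ₗ κ) →₀ AddMonoidAlgebra K α)}
    (hgs : IsGroebnerBasis (potLE le) {g | g ∈ gs}) :
    IsGroebnerBasis (potLE le) {s | s ∈ filterSyzygyBasis gs} := by
  intro p q r hq hr
  obtain ⟨z, hqz, hrz⟩ := hgs _ _ _
    (hq.lift (extendFirst K α κ m) fun _ _ => red_extendFirst)
    (hr.lift (extendFirst K α κ m) fun _ _ => red_extendFirst)
  -- The common reduct `z` is reached from the image, so it lies in the image.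
  obtain ⟨w, rfl, hqw⟩ := hqz.exists_of_map_step exists_of_red_extendFirst
  obtain ⟨w', hw', hrw⟩ := hrz.exists_of_map_step exists_of_red_extendFirst
  obtain rfl := extendFirst_injective hw'
  exact ⟨w, hqw, hrw⟩

theorem IsGroebnerBasis.mem_span_filterSyzygyBasis_iff {le : α → α → Prop}
    (hle : IsAdmissible le) {gs : List ((Fin m ⊕ₗ κ) →₀ AddMonoidAlgebra K α)}
    (hgs : IsGroebnerBasis (potLE le) {g | g ∈ gs}) (p : Fin m →₀ AddMonoidAlgebra K α) :
    p ∈ Submodule.span (AddMonoidAlgebra K α) {s | s ∈ GB.filterSyzygyBasis gs} ↔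
      extendFirst K α κ m p ∈ Submodule.span (AddMonoidAlgebra K α) {g | g ∈ gs} := by
  constructor
  · intro h
    refine Submodule.span_le (p := (Submodule.span _ {g | g ∈ gs}).comap (extendFirst K α κ m)).2
      (fun f hf => Submodule.subset_span (mem_filterSyzygyBasis.1 hf)) h
  · intro h
    obtain ⟨q, hq, hpq⟩ :=
      (hgs.reflTransGen_red_zero hle h).exists_of_map_step exists_of_red_extendFirst
    obtain rfl : q = 0 := extendFirst_injective (by rw [← hq, map_zero])
    exact mem_span_of_reflTransGen_red_zero hpq

end Extension

/-! ### The module generated by the `(e_i, b_i)` -/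

section Syzygy

variable {K : Type*} [Field K] {α : Type*} [AddCancelCommMonoid α] {κ : Type*}

theorem mem_span_initSyzygyList_iff (bs : List (κ →₀ AddMonoidAlgebra K α))
    (x : (Fin bs.length ⊕ₗ κ) →₀ AddMonoidAlgebra K α) :
    x ∈ Submodule.span (AddMonoidAlgebra K α) {b | b ∈ initSyzygyList bs} ↔
      ∃ s : Fin bs.length →₀ AddMonoidAlgebra K α, x = extendFirst K α κ _ s +
        Finsupp.lmapDomain _ (AddMonoidAlgebra K α)
          (fun j : κ => (Sum.inrₗ j : Fin bs.length ⊕ₗ κ)) (∑ i, s i • bs.get i) := by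
  have hset : {b | b ∈ initSyzygyList bs} = Set.range fun i : Fin bs.length =>
      extendFirst K α κ _ (Finsupp.single i 1) + Finsupp.lmapDomain _ (AddMonoidAlgebra K α)
        (fun j : κ => (Sum.inrₗ j : Fin bs.length ⊕ₗ κ)) (bs.get i) := by
    ext b
    simp [initSyzygyList, extendFirst, List.mem_ofFn]
  rw [hset, Submodule.mem_span_range_iff_exists_fun]
  have key (c : Fin bs.length → AddMonoidAlgebra K α) :
      ∑ i, c i • Finsupp.single i (1 : AddMonoidAlgebra K α) = Finsupp.equivFunOnFinite.symm c := by
    ext1 i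
    simp [Finsupp.finsetSum_apply, Finsupp.single_apply]
  simp only [smul_add, ← map_smul, Finset.sum_add_distrib, ← map_sum, key]
  constructor
  · rintro ⟨c, rfl⟩
    exact ⟨Finsupp.equivFunOnFinite.symm c, rfl⟩
  · rintro ⟨s, rfl⟩
    exact ⟨s, by simp⟩

theorem extendFirst_mem_span_initSyzygyList_iff (bs : List (κ →₀ AddMonoidAlgebra K α))
    (p : Fin bs.length →₀ AddMonoidAlgebra K α) :
    extendFirst K α κ _ p ∈ Submodule.span (AddMonoidAlgebra K α) {b | b ∈ initSyzygyList bs} ↔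
      p ∈ syzygyModule bs := by
  rw [mem_span_initSyzygyList_iff]
  change _ ↔ ∑ i, p i • bs.get i = 0
  have hinj : Function.Injective fun j : κ => (Sum.inrₗ j : Fin bs.length ⊕ₗ κ) :=
    toLex.injective.comp Sum.inr_injective
  constructor
  · rintro ⟨s, hs⟩
    -- The first `m` components determine the coefficients; the others then force the sum to vanish.
    obtain rfl : p = s := by
      ext1 i
      have h := DFunLike.congr_fun hs (Sum.inlₗ i)
      rw [Finsupp.add_apply, Finsupp.lmapDomain_apply, Finsupp.mapDomain_of_notMem_range _ _ (by simp)]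
        at h
      simpa using h
    rw [left_eq_add, Finsupp.lmapDomain_apply] at hs
    exact Finsupp.mapDomain_injective hinj (hs.trans Finsupp.mapDomain_zero.symm)
  · intro h
    exact ⟨p, by rw [h, map_zero, add_zero]⟩

end Syzygy

end GB

theorem mainTheorem6 {K : Type*} [Field K] {α : Type*} [AddCancelCommMonoid α]
    (le : α → α → Prop) (hle : GB.IsAdmissible le)
    {κ : Type*} [LinearOrder κ]
    (bs : List (κ →₀ AddMonoidAlgebra K α)) (hbs : bs.Nodup)
    (gs : List ((Fin bs.length ⊕ₗ κ) →₀ AddMonoidAlgebra K α))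
    (hgs : GB.IsGroebnerBasis (GB.potLE le) {g | g ∈ gs})
    (hspan : Submodule.span (AddMonoidAlgebra K α) {g | g ∈ gs} =
      Submodule.span (AddMonoidAlgebra K α) {b | b ∈ GB.initSyzygyList bs}) :
    Submodule.span (AddMonoidAlgebra K α) {s | s ∈ GB.filterSyzygyBasis gs} =
        GB.syzygyModule bs ∧
      GB.IsGroebnerBasis (GB.potLE le) {s | s ∈ GB.filterSyzygyBasis gs} := by
  refine ⟨?_, hgs.filterSyzygyBasis⟩
  ext p
  rw [hgs.mem_span_filterSyzygyBasis_iff hle, hspan,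
    GB.extendFirst_mem_span_initSyzygyList_iff]
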